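/- **Setting.** Let $K\ge 2$ actions and contexts in $\mathcal W=[0,1]^d$ be given. A policy is a map $f:[K]\times\mathcal W\to\mathbb R_+$ with $\sum_{a\in[K]} f(a,w)=1$ for all $w$. Let $\mathcal F$ be a nonempty convex set of policies such that, for any finitely many contexts $v_1,\dots,v_m$, the set of value vectors $\{(f(a,v_j))_{a\in[K],\,j\le m}: f\in\mathcal F\}$ is compact. *Search step of Generalized Policy Elimination (GPE) at time $t\ge 1$.* Let $p>0$, $\delta_\tau=\tau^{-\min(1/2,\,1/(2p))}$, and thresholds $x_\tau\ge 0$ be given. Let $O_\tau=(W_\tau,A_\tau,Y_\tau)\in\mathcal W\times[K]\times\{0,1\}$, $\tau\le t-1$, be the past observations, $\tilde g_1,\dots,\tilde g_{t-1}$ the policies found in the previous rounds (any policies are allowed), and $g_\tau=\delta_\tau/K+(1-\delta_\tau)\tilde g_\tau$ the designs. With $$\widehat R_\tau(f)=\frac1\tau\sum_{s=1}^{\tau}\frac{1/K}{g_s(A_s,W_s)}\,f(A_s,W_s)(1-Y_s),$$ put $\mathcal F_1=\mathcal F$ and $\mathcal F_{\tau+1}=\{f\in\mathcal F_\tau:\widehat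 R_\tau(f)\le\min_{f'\in\mathcal F_\tau}\widehat R_\tau(f')+x_\tau\}$. The exploration policy search step at time $t$ is to find $\tilde g_t\in\mathcal F_t$ such that, for all $f\in\mathcal F_t$, $$\frac1{t-1}\sum_{\tau=1}^{t-1}\sum_{a\in[K]}\frac{f(a,W_\tau)}{\delta_t/K+(1-\delta_t)\,\tilde g_t(a,W_\tau)}\le 2K$$ (for $t=1$ this inequality is void). *Oracles.* Given $n,q\ge1$, contexts $w_1,\dots,w_n$, vectors $u_1,\dots,u_q\in\mathbb R^{Kn}$, scalars $b_1,\dots,b_q$, and a vector $c\in\mathbb R^{Kn}$, the linearly constrained least-squares oracle (LCLSO) over $\mathcal F$ returns, if there is one, a minimizer of $\sum_{a,j}(c(a,j)-f(a,w_j))^2$ over the $f\in\mathcal F$ with $\sum_{a,j}u_m(a,j)f(a,w_j)\le b_m$ for all $m\le q$. For $c\ge0$, the linearly constrained cost-sensitive classification oracle (LCCSCO) over $\mathcal F$ returns, if there is one, a minimizer of $\sum_{a,j}c(a,j)f(a,w_j)$ under the same constraints. Where no solution exists the answer is arbitrary. **Theorem.** There are a universal constant $C>0$ and a deterministic adaptive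 procedure that does not know $\mathcal F$ and accesses it only by calling the two oracles (between calls it may compute with the answers, with $K,d,t,p$, and with the $x_\tau$, $O_\tau$, $\tilde g_\tau$), such that for all $K\ge2$, $d$, $t\ge1$, all data and all $\mathcal F$ as above, and all LCLSO and LCCSCO over $\mathcal F$, the procedure outputs a $\tilde g_t$ that solves the exploration policy search step at time $t$ after at most $$C\,(Kt)^2\log(\max\{t,2\})$$ calls to LCLSO and LCCSCO in total. -/

import Mathlib

open scoped BigOperators

noncomputable section

namespace GPE

/-- The context space `[0,1]^d`. -/
abbrev Ctx (d : ℕ) : Type := Fin d → unitInterval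

/-- Real-valued functions of an action and a context. -/
abbrev ActionFn (K d : ℕ) : Type := Fin K → Ctx d → ℝ

/-- A policy maps every context to a probability distribution over the `K` actions. -/
structure IsPolicy {K d : ℕ} (f : ActionFn K d) : Prop where
  nonneg : ∀ a w, 0 ≤ f a w
  sum_eq_one : ∀ w, ∑ a, f a w = 1

/-- The uniform reference design. -/
def uniformDesign (K d : ℕ) : ActionFn K d := fun _ _ => (K : ℝ)⁻¹

/-- The mixture `δ * uniform + (1 - δ) * g`. -/
def mixDesign {K d : ℕ} (δ : ℝ) (g : ActionFn K d) : ActionFn K d :=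
  fun a w => δ * uniformDesign K d a w + (1 - δ) * g a w

/-- Standing assumptions on the policy class: it is a nonempty convex set of policies whose set of
value vectors at any finitely many contexts is compact. -/
structure IsPolicyClass {K d : ℕ} (F : Set (ActionFn K d)) : Prop where
  nonempty : F.Nonempty
  isPolicy : ∀ f ∈ F, IsPolicy f
  convex : Convex ℝ F
  compact_values : ∀ (m : ℕ) (v : Fin m → Ctx d),
    IsCompact ((fun (f : ActionFn K d) (a : Fin K) (j : Fin m) => f a (v j)) '' F)

/-! ### The two optimization oracles -/

/-- The data of an oracle call: contexts `W_1, …, W_n` with `n ≥ 1`, a vector of size `K n`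
(the regression targets, or the costs), and `q ≥ 1` linear constraints. -/
structure OracleQuery (K d : ℕ) : Type where
  n : ℕ
  n_pos : 1 ≤ n
  q : ℕ
  q_pos : 1 ≤ q
  ctx : Fin n → Ctx d
  vec : Fin K → Fin n → ℝ
  u : Fin q → Fin K → Fin n → ℝ
  b : Fin q → ℝ

namespace OracleQuery

variable {K d : ℕ}

/-- `f` belongs to the class and satisfies the linear constraints of the query. -/
def Feasible (Q : OracleQuery K d) (F : Set (ActionFn K d)) (f : ActionFn K d) : Prop :=
  f ∈ F ∧ ∀ m, ∑ a, ∑ τ, Q.u m a τ * f a (Q.ctx τ) ≤ Q.b m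

/-- The least-squares objective. -/
def squaredLoss (Q : OracleQuery K d) (f : ActionFn K d) : ℝ :=
  ∑ a, ∑ τ, (Q.vec a τ - f a (Q.ctx τ)) ^ 2

/-- The cost-sensitive classification objective. -/
def cost (Q : OracleQuery K d) (f : ActionFn K d) : ℝ :=
  ∑ a, ∑ τ, Q.vec a τ * f a (Q.ctx τ)

/-- `f` solves the linearly constrained least-squares problem over `F`. -/
def SolvesLS (Q : OracleQuery K d) (F : Set (ActionFn K d)) (f : ActionFn K d) : Prop :=
  Q.Feasible F f ∧ ∀ f', Q.Feasible F f' → Q.squaredLoss f ≤ Q.squaredLoss f'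

/-- `f` solves the linearly constrained cost-sensitive classification problem over `F`. -/
def SolvesCC (Q : OracleQuery K d) (F : Set (ActionFn K d)) (f : ActionFn K d) : Prop :=
  Q.Feasible F f ∧ ∀ f', Q.Feasible F f' → Q.cost f ≤ Q.cost f'

end OracleQuery

/-- A linearly constrained least-squares oracle over `F`: on every query it returns a solution if
there is one (and an uninformative, arbitrary answer otherwise). -/
def IsLCLSO {K d : ℕ} (F : Set (ActionFn K d)) (O : OracleQuery K d → ActionFn K d) : Prop :=
  ∀ Q : OracleQuery K d, (∃ f, Q.SolvesLS F f) → Q.SolvesLS F (O Q)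

/-- A linearly constrained cost-sensitive classification oracle over `F`: on every query with
nonnegative costs it returns a solution if there is one (its answers are arbitrary otherwise). -/
def IsLCCSCO {K d : ℕ} (F : Set (ActionFn K d)) (O : OracleQuery K d → ActionFn K d) : Prop :=
  ∀ Q : OracleQuery K d, (∀ a τ, 0 ≤ Q.vec a τ) → (∃ f, Q.SolvesCC F f) → Q.SolvesCC F (O Q)

/-! ### Adaptive procedures with oracle calls -/

/-- A deterministic adaptive procedure that returns a function of action and context. It either
stops with an output or calls one of the two oracles and continues in a way that depends on the
answer. Nothing in it refers to a policy class: the class can only be accessed by oracle calls. -/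
inductive OracleProc (K d : ℕ) : Type
  | output (f : ActionFn K d) : OracleProc K d
  | callLS (Q : OracleQuery K d) (next : ActionFn K d → OracleProc K d) : OracleProc K d
  | callCC (Q : OracleQuery K d) (next : ActionFn K d → OracleProc K d) : OracleProc K d

namespace OracleProc

variable {K d : ℕ}

/-- The output of a procedure when its calls are answered by the oracles `ls` and `cc`. -/
def run (ls cc : OracleQuery K d → ActionFn K d) : OracleProc K d → ActionFn K d
  | output f => f
  | callLS Q next => run ls cc (next (ls Q))
  | callCC Q next => run ls cc (next (cc Q))

/-- The total number of oracle calls, to either oracle, made in that execution. -/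
def calls (ls cc : OracleQuery K d → ActionFn K d) : OracleProc K d → ℕ
  | output _ => 0
  | callLS Q next => calls ls cc (next (ls Q)) + 1
  | callCC Q next => calls ls cc (next (cc Q)) + 1

end OracleProc

/-! ### The exploration policy search step -/

/-- An observation: context, action and binary reward. -/
structure Obs (K d : ℕ) : Type where
  ctx : Ctx d
  act : Fin K
  rew : Fin 2

/-- The exploration rate `δ_τ = τ ^ (-(1/2 ∧ 1/(2p)))`. -/
def rate (p : ℝ) (τ : ℕ) : ℝ := (τ : ℝ) ^ (-(min (1 / 2) (1 / (2 * p))))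

/-- What is known before the search step at time `t`, apart from the policy class: the entropy
exponent `p`, the elimination thresholds `x_τ`, the observations `O_1, …, O_{t-1}` and the
policies `g̃_1, …, g̃_{t-1}` previously found. Position `s : Fin (t - 1)` stands for time `s + 1`. -/
structure SearchInput (K d t : ℕ) : Type where
  p : ℝ
  p_pos : 0 < p
  x : ℕ → ℝ
  x_nonneg : ∀ τ, 1 ≤ τ → 0 ≤ x τ
  obs : Fin (t - 1) → Obs K d
  prev : Fin (t - 1) → ActionFn K d
  prev_isPolicy : ∀ s, IsPolicy (prev s)

namespace SearchInput

variable {K d t : ℕ}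

/-- The design `g_τ = δ_τ * uniform + (1 - δ_τ) * g̃_τ` carried out at time `τ = s + 1`. -/
def design (D : SearchInput K d t) (s : Fin (t - 1)) : ActionFn K d :=
  mixDesign (rate D.p (s + 1)) (D.prev s)

/-- The importance-weighted loss `ℓ_τ(f)(O_τ)` at time `τ = s + 1`. -/
def loss (D : SearchInput K d t) (s : Fin (t - 1)) (f : ActionFn K d) : ℝ :=
  let o := D.obs s
  uniformDesign K d o.act o.ctx / D.design s o.act o.ctx * f o.act o.ctx
    * (1 - ((o.rew : ℕ) : ℝ))

/-- The empirical risk of `f` over the observations at times `1, …, τ`, for `τ ≤ t - 1`. -/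
def empRisk (D : SearchInput K d t) (τ : ℕ) (f : ActionFn K d) : ℝ :=
  (1 / (τ : ℝ)) * ∑ s ∈ Finset.univ.filter (fun s : Fin (t - 1) => (s : ℕ) < τ), D.loss s f

/-- The candidate sets: `F_1 = F`, and `F_{τ+1}` consists of the `f ∈ F_τ` whose empirical risk at
time `τ` is at most `x_τ` above the minimum over `F_τ`, for `1 ≤ τ ≤ t - 1`. -/
def candidates (D : SearchInput K d t) (F : Set (ActionFn K d)) : ℕ → Set (ActionFn K d)
  | 0 => F
  | 1 => F
  | τ + 2 => {f | f ∈ D.candidates F (τ + 1) ∧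
      ∀ f' ∈ D.candidates F (τ + 1), D.empRisk (τ + 1) f ≤ D.empRisk (τ + 1) f' + D.x (τ + 1)}

/-- The requirement on the policy `g` found by the exploration policy search step at time `t`.
For `t = 1` the sum is empty and only membership is required. -/
def IsExplorationPolicy (D : SearchInput K d t) (F : Set (ActionFn K d)) (g : ActionFn K d) :
    Prop :=
  g ∈ D.candidates F t ∧ ∀ f ∈ D.candidates F t,
    (1 / ((t : ℝ) - 1)) * ∑ s, ∑ a,
      f a (D.obs s).ctx / mixDesign (rate D.p t) g a (D.obs s).ctx ≤ 2 * (K : ℝ)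

end SearchInput

end GPE

end

open scoped BigOperators

noncomputable section

namespace GPE

variable {K d t : ℕ}

/-! ### Growth of a product under a convex step -/

/-! The candidate set at time `t` is cut out of `F` by `t - 1` half-spaces, since empirical risks
are linear in the policy values with nonnegative coefficients. The cost-sensitive oracle finds the
minimal risks, hence the half-spaces, one at a time, and a zero-cost call supplies a candidate to
start from (`run_eliminate`).

A suitable `g` is then found by conditional gradient ascent on the product of the `N = (t - 1) * K`
mixture values (`potential`). The derivative of its logarithm towards `f` is the sum of the ratios
of mixture values of `f` and `g`, minus `N`. At an exact maximizer it is nonpositive, which would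
give average spread at most `K`. The slack up to `2 * K` makes every step at a violation multiply
the potential by at least `25 / 24` (`potential_step`). The potential lies between `(K * t) ^ (-(t *
K))` and `1`, so the ascent stops within order `K * t * log (K * t)` steps, well inside the claimed
bound. The worst `f` for a given `g` comes from one oracle call, because the spread is linear in
`f`. -/

theorem one_add_sum_le_prod_one_add {ι : Type*} (s : Finset ι) (x : ι → ℝ) (hx : ∀ i, 0 ≤ x i) :
    1 + ∑ i ∈ s, x i ≤ ∏ i ∈ s, (1 + x i) := by
  classical
  induction s using Finset.induction_on with
  | empty => simp
  | insert i s hi ih =>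
    rw [Finset.sum_insert hi, Finset.prod_insert hi]
    have h0 : 0 ≤ ∑ j ∈ s, x j := Finset.sum_nonneg fun j _ => hx j
    nlinarith [hx i, mul_le_mul_of_nonneg_left ih (by linarith [hx i] : 0 ≤ 1 + x i),
      mul_nonneg (hx i) h0]

/-- With `l = 1 / (6 * N)` and ratios `r = u / v`, each new factor is at least `(1 - l) * (1 + l *
r) * v`; the difference is `l ^ 2 * u`. Bernoulli bounds the product of the `1 - l` below by `5 /
6`, and the hypothesis bounds that of the `1 + l * r` by `5 / 4`. -/
theorem prod_convex_step {ι : Type*} [Fintype ι] [Nonempty ι] (v u : ι → ℝ) (hv : ∀ i, 0 < v i)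
    (hu : ∀ i, 0 ≤ u i) (hr : 3 / 2 * (Fintype.card ι : ℝ) ≤ ∑ i, u i / v i) :
    25 / 24 * ∏ i, v i ≤ ∏ i, ((1 - 1 / (6 * (Fintype.card ι : ℝ))) * v i
      + 1 / (6 * (Fintype.card ι : ℝ)) * u i) := by
  set N : ℝ := (Fintype.card ι : ℝ) with hN
  have hN1 : 1 ≤ N := by
    rw [hN]; exact_mod_cast Fintype.card_pos
  set l : ℝ := 1 / (6 * N) with hl
  have hl0 : 0 < l := by positivity
  have hlN : N * l = 1 / 6 := by rw [hl]; field_simp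
  have hl1 : l ≤ 1 / 6 := by nlinarith
  have hr0 : ∀ i, 0 ≤ u i / v i := fun i => div_nonneg (hu i) (hv i).le
  have hpow : 5 / 6 ≤ (1 - l) ^ Fintype.card ι := by
    have h := one_add_mul_le_pow (a := -l) (by linarith) (Fintype.card ι)
    rw [← sub_eq_add_neg] at h
    have : 1 + (Fintype.card ι : ℝ) * -l = 5 / 6 := by rw [← hN]; linarith
    linarith
  have hprod : 5 / 4 ≤ ∏ i, (1 + l * (u i / v i)) := by
    refine le_trans ?_ (one_add_sum_le_prod_one_add Finset.univ _
      fun i => mul_nonneg hl0.le (hr0 i))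
    rw [← Finset.mul_sum]
    nlinarith [mul_le_mul_of_nonneg_left hr hl0.le]
  have hP : 0 < ∏ i, v i := Finset.prod_pos fun i _ => hv i
  calc 25 / 24 * ∏ i, v i = 5 / 6 * (5 / 4) * ∏ i, v i := by ring
    _ ≤ (1 - l) ^ Fintype.card ι * (∏ i, (1 + l * (u i / v i))) * ∏ i, v i := by
      gcongr
    _ = ∏ i, ((1 - l) * (1 + l * (u i / v i)) * v i) := by
      rw [Finset.prod_mul_distrib, Finset.prod_mul_distrib, Finset.prod_const, Finset.card_univ]
    _ ≤ _ := by
      refine Finset.prod_le_prod (fun i _ => ?_) fun i _ => ?_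
      · have := hr0 i
        have := hv i
        have : 0 ≤ 1 - l := by linarith
        positivity
      · have h1 : u i / v i * v i = u i := div_mul_cancel₀ _ (hv i).ne'
        have : (1 - l) * (1 + l * (u i / v i)) * v i
            = (1 - l) * v i + l * u i - l * l * u i := by
          linear_combination (l - l * l) * h1
        rw [this]
        have := mul_nonneg (mul_nonneg hl0.le hl0.le) (hu i)
        linarith

/-! ### Policies and mixture designs -/

theorem IsPolicy.le_one {f : ActionFn K d} (hf : IsPolicy f) (a : Fin K) (w : Ctx d) :
    f a w ≤ 1 := by
  rw [← hf.sum_eq_one w]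
  exact Finset.single_le_sum (f := fun a => f a w) (fun b _ => hf.nonneg b w) (Finset.mem_univ a)

theorem mixDesign_ge {δ : ℝ} (hδ1 : δ ≤ 1) {g : ActionFn K d} (hg : IsPolicy g)
    (a : Fin K) (w : Ctx d) : δ * (K : ℝ)⁻¹ ≤ mixDesign δ g a w := by
  have := mul_nonneg (by linarith : 0 ≤ 1 - δ) (hg.nonneg a w)
  simp only [mixDesign, uniformDesign]
  linarith

theorem mixDesign_pos {δ : ℝ} (hK : 0 < K) (hδ0 : 0 < δ) (hδ1 : δ ≤ 1) {g : ActionFn K d}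
    (hg : IsPolicy g) (a : Fin K) (w : Ctx d) : 0 < mixDesign δ g a w := by
  have hK' : (0 : ℝ) < K := by exact_mod_cast hK
  exact lt_of_lt_of_le (by positivity) (mixDesign_ge hδ1 hg a w)

theorem isPolicy_mixDesign {δ : ℝ} (hK : 0 < K) (hδ0 : 0 < δ) (hδ1 : δ ≤ 1) {g : ActionFn K d}
    (hg : IsPolicy g) : IsPolicy (mixDesign δ g) where
  nonneg a w := (mixDesign_pos hK hδ0 hδ1 hg a w).le
  sum_eq_one w := by
    have hK' : (K : ℝ) ≠ 0 := by exact_mod_cast hK.ne'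
    simp only [mixDesign, uniformDesign, Finset.sum_add_distrib, ← Finset.mul_sum, hg.sum_eq_one]
    simp [hK']

theorem mixDesign_convex (δ l : ℝ) (f g : ActionFn K d) (a : Fin K) (w : Ctx d) :
    mixDesign δ ((1 - l) • g + l • f) a w
      = (1 - l) * mixDesign δ g a w + l * mixDesign δ f a w := by
  simp only [mixDesign, Pi.add_apply, Pi.smul_apply, smul_eq_mul]
  ring

/-- The reciprocals of a positive probability vector on `K` points sum to at least `K ^ 2`. -/
theorem sq_le_sum_inv (v : Fin K → ℝ) (hv : ∀ a, 0 < v a) (h1 : ∑ a, v a = 1) :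
    (K : ℝ) ^ 2 ≤ ∑ a, (v a)⁻¹ := by
  -- Tangent line to the convex function `1 / v` at `v = 1 / K`.
  have h : ∀ a, 2 * (K : ℝ) - K ^ 2 * v a ≤ (v a)⁻¹ := fun a => by
    rw [inv_eq_one_div, le_div_iff₀ (hv a)]
    nlinarith [sq_nonneg ((K : ℝ) * v a - 1)]
  have := Finset.sum_le_sum fun a (_ : a ∈ Finset.univ) => h a
  rw [Finset.sum_sub_distrib, ← Finset.mul_sum, ← Finset.mul_sum, h1] at this
  simp at this
  linarith

theorem rate_pos {p : ℝ} {τ : ℕ} (hτ : 1 ≤ τ) : 0 < rate p τ :=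
  Real.rpow_pos_of_pos (by exact_mod_cast hτ) _

theorem rate_le_one {p : ℝ} (hp : 0 < p) {τ : ℕ} (hτ : 1 ≤ τ) : rate p τ ≤ 1 := by
  refine Real.rpow_le_one_of_one_le_of_nonpos (by exact_mod_cast hτ) ?_
  have : 0 < min (1 / 2) (1 / (2 * p)) := lt_min (by norm_num) (by positivity)
  linarith

/-- A crude bound free of `p`, sufficient because the potential enters only through its logarithm.
-/
theorem inv_le_rate {p : ℝ} {τ : ℕ} (hτ : 1 ≤ τ) : (τ : ℝ)⁻¹ ≤ rate p τ := by
  rw [← Real.rpow_neg_one]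
  refine Real.rpow_le_rpow_of_exponent_le (by exact_mod_cast hτ) ?_
  have : min (1 / 2) (1 / (2 * p)) ≤ 1 / 2 := min_le_left _ _
  linarith

/-! ### Existence of oracle solutions -/

/-- Costs and constraints depend only on the values at the queried contexts, and these values range
over a compact set. -/
theorem OracleQuery.exists_solvesCC {F : Set (ActionFn K d)} (hF : IsPolicyClass F)
    (Q : OracleQuery K d) (h : ∃ f, Q.Feasible F f) : ∃ f, Q.SolvesCC F f := by
  have hc := hF.compact_values Q.n Q.ctx
  set V := (fun (f : ActionFn K d) (a : Fin K) (j : Fin Q.n) => f a (Q.ctx j)) '' F with hV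
  set S : Set (Fin K → Fin Q.n → ℝ) := {y | ∀ m, ∑ a, ∑ τ, Q.u m a τ * y a τ ≤ Q.b m} with hS
  have hSc : IsClosed S := by
    rw [hS, Set.ofPred_forall]
    refine isClosed_iInter fun m => isClosed_le ?_ continuous_const
    fun_prop
  obtain ⟨f, hf, hfu⟩ := h
  obtain ⟨y, ⟨⟨g, hg, rfl⟩, hgS⟩, hmin⟩ := (hc.inter_right hSc).exists_isMinOn
    (f := fun y => ∑ a, ∑ τ, Q.vec a τ * y a τ) ⟨_, Set.mem_image_of_mem _ hf, hfu⟩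
    (by fun_prop)
  exact ⟨g, ⟨hg, hgS⟩, fun f' hf' => hmin ⟨Set.mem_image_of_mem _ hf'.1, hf'.2⟩⟩

theorem IsLCCSCO.solvesCC {F : Set (ActionFn K d)} {cc : OracleQuery K d → ActionFn K d}
    (hcc : IsLCCSCO F cc) (hF : IsPolicyClass F) (Q : OracleQuery K d)
    (hQ : ∀ a τ, 0 ≤ Q.vec a τ) (h : ∃ f, Q.Feasible F f) : Q.SolvesCC F (cc Q) :=
  hcc Q hQ (Q.exists_solvesCC hF h)

namespace SearchInput

/-! ### Empirical risks as linear functionals and candidate sets as half-space intersections -/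

/-- The coefficients of the empirical risk as a linear functional of the values of a policy. -/
def riskCoef (D : SearchInput K d t) (τ : ℕ) (a : Fin K) (s : Fin (t - 1)) : ℝ :=
  if (s : ℕ) < τ ∧ a = (D.obs s).act then
    1 / (τ : ℝ) * ((K : ℝ)⁻¹ / D.design s (D.obs s).act (D.obs s).ctx
      * (1 - (((D.obs s).rew : ℕ) : ℝ)))
  else 0

theorem sum_riskCoef (D : SearchInput K d t) (τ : ℕ) (f : ActionFn K d) :
    ∑ a, ∑ s, D.riskCoef τ a s * f a (D.obs s).ctx = D.empRisk τ f := by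
  rw [Finset.sum_comm, empRisk, Finset.mul_sum, Finset.sum_filter]
  refine Finset.sum_congr rfl fun s _ => ?_
  by_cases hs : (s : ℕ) < τ
  · simp only [riskCoef, hs, true_and, if_true, ite_mul, zero_mul, Finset.sum_ite_eq',
      Finset.mem_univ, loss, uniformDesign]
    ring
  · simp [riskCoef, hs]

/-- The cost-sensitive oracle is reliable only for nonnegative costs, so this is what allows the
risks to be minimized with it. -/
theorem riskCoef_nonneg (hK : 0 < K) (D : SearchInput K d t) (τ : ℕ) (a : Fin K)
    (s : Fin (t - 1)) : 0 ≤ D.riskCoef τ a s := by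
  unfold riskCoef
  split_ifs
  · have h1 : 0 < D.design s (D.obs s).act (D.obs s).ctx := by
      have := rate_le_one D.p_pos (τ := (s : ℕ) + 1) (by omega)
      have := rate_pos (p := D.p) (τ := (s : ℕ) + 1) (by omega)
      apply mixDesign_pos hK _ _ (D.prev_isPolicy s) <;> assumption
    have h2 : (((D.obs s).rew : ℕ) : ℝ) ≤ 1 := by
      have := (D.obs s).rew.is_lt
      exact_mod_cast Nat.le_of_lt_succ this
    have : 0 ≤ 1 - (((D.obs s).rew : ℕ) : ℝ) := by linarith
    positivity
  · exact le_rfl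

/-- The query with costs `c` over the members of the class whose first `τ` empirical risks are
bounded by `b`. -/
def query (D : SearchInput K d t) (ht : 1 ≤ t - 1) (c : Fin K → Fin (t - 1) → ℝ) (τ : ℕ)
    (b : ℕ → ℝ) : OracleQuery K d where
  n := t - 1
  n_pos := ht
  q := t - 1
  q_pos := ht
  ctx s := (D.obs s).ctx
  vec := c
  -- Unused rows become `0 ≤ 0`; this keeps the number of constraints positive even for `τ = 0`.
  u m := if (m : ℕ) < τ then D.riskCoef (m + 1) else 0
  b m := if (m : ℕ) < τ then b m else 0

/-- The members of the class whose first `τ` empirical risks are bounded by `b`. -/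
def sublevel (D : SearchInput K d t) (F : Set (ActionFn K d)) (τ : ℕ) (b : ℕ → ℝ) :
    Set (ActionFn K d) :=
  {f | f ∈ F ∧ ∀ m < τ, D.empRisk (m + 1) f ≤ b m}

theorem query_feasible_iff (D : SearchInput K d t) (ht : 1 ≤ t - 1)
    (c : Fin K → Fin (t - 1) → ℝ) {τ : ℕ} (hτ : τ ≤ t - 1) (b : ℕ → ℝ)
    (F : Set (ActionFn K d)) (f : ActionFn K d) :
    (D.query ht c τ b).Feasible F f ↔ f ∈ D.sublevel F τ b := by
  refine and_congr_right fun _ => ⟨fun h m hm => ?_, fun h m => ?_⟩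
  · have := h ⟨m, lt_of_lt_of_le hm hτ⟩
    simp only [query, hm, if_true] at this
    exact (D.sum_riskCoef (m + 1) f).symm.trans_le this
  · by_cases hm : (m : ℕ) < τ
    · simp only [query, hm, if_true]
      exact (D.sum_riskCoef (m + 1) f).trans_le (h _ hm)
    · simp [query, hm]

theorem empRisk_convex (D : SearchInput K d t) (τ : ℕ) (x y : ℝ) (f g : ActionFn K d) :
    D.empRisk τ (x • f + y • g) = x * D.empRisk τ f + y * D.empRisk τ g := by
  simp only [← sum_riskCoef, Pi.add_apply, Pi.smul_apply, smul_eq_mul, Finset.mul_sum,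
    ← Finset.sum_add_distrib]
  exact Finset.sum_congr rfl fun _ _ => Finset.sum_congr rfl fun _ _ => by ring

theorem convex_sublevel (D : SearchInput K d t) {F : Set (ActionFn K d)} (hF : Convex ℝ F)
    (τ : ℕ) (b : ℕ → ℝ) : Convex ℝ (D.sublevel F τ b) := by
  intro f hf g hg x y hx hy hxy
  refine ⟨hF hf.1 hg.1 hx hy hxy, fun m hm => ?_⟩
  rw [empRisk_convex]
  calc _ ≤ x * b m + y * b m := by
        gcongr
        exacts [hf.2 m hm, hg.2 m hm]
    _ = b m := by rw [← add_mul, hxy, one_mul]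

/-! ### The exploration phase -/

/-- The exploration rate at the time of the search. -/
def delta (D : SearchInput K d t) : ℝ := rate D.p t

/-- The sum whose average is bounded in the exploration policy search step. -/
def spread (D : SearchInput K d t) (f g : ActionFn K d) : ℝ :=
  ∑ s, ∑ a, f a (D.obs s).ctx / mixDesign D.delta g a (D.obs s).ctx

/-- Nonnegative costs whose minimization is equivalent to the maximization of the spread. -/
def spreadCost (D : SearchInput K d t) (g : ActionFn K d) (a : Fin K) (s : Fin (t - 1)) : ℝ :=
  K / D.delta - 1 / mixDesign D.delta g a (D.obs s).ctx

/-- The step size of the exploration phase. -/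
def stepSize (K t : ℕ) : ℝ := 1 / (6 * ((t - 1 : ℕ) * K : ℝ))

/-- The exploration phase: conditional gradient steps for the sum of the logarithms of the mixture
design, stopped as soon as the requirement on the exploration policy is met. -/
def explore (D : SearchInput K d t) (ht : 1 ≤ t - 1) (b : ℕ → ℝ) :
    ℕ → ActionFn K d → OracleProc K d
  | 0, g => .output g
  | k + 1, g => .callCC (D.query ht (D.spreadCost g) (t - 1) b) fun f =>
      open Classical in
      if D.spread f g ≤ 2 * K * (t - 1 : ℕ) then .output g
      else D.explore ht b k ((1 - stepSize K t) • g + stepSize K t • f)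

/-- The product of the values of the mixture design. -/
def potential (D : SearchInput K d t) (g : ActionFn K d) : ℝ :=
  ∏ i : Fin (t - 1) × Fin K, mixDesign D.delta g i.2 (D.obs i.1).ctx

theorem delta_pos (D : SearchInput K d t) (ht : 1 ≤ t) : 0 < D.delta := rate_pos ht

theorem delta_le_one (D : SearchInput K d t) (ht : 1 ≤ t) : D.delta ≤ 1 :=
  rate_le_one D.p_pos ht

theorem inv_mixDesign_le (hK : 0 < K) (ht : 1 ≤ t) (D : SearchInput K d t) {g : ActionFn K d}
    (hg : IsPolicy g) (a : Fin K) (w : Ctx d) :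
    1 / mixDesign D.delta g a w ≤ K / D.delta := by
  have hK' : (0 : ℝ) < K := by exact_mod_cast hK
  have hδ := D.delta_pos ht
  have : (K : ℝ) / D.delta = 1 / (D.delta * (K : ℝ)⁻¹) := by field_simp
  rw [this]
  exact one_div_le_one_div_of_le (by positivity) (mixDesign_ge (D.delta_le_one ht) hg a w)

theorem potential_le_one (hK : 0 < K) (ht : 1 ≤ t) (D : SearchInput K d t) {g : ActionFn K d}
    (hg : IsPolicy g) : D.potential g ≤ 1 := by
  have h := isPolicy_mixDesign hK (D.delta_pos ht) (D.delta_le_one ht) hg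
  exact Finset.prod_le_one (fun i _ => h.nonneg _ _) fun i _ => h.le_one _ _

theorem le_potential (ht : 1 ≤ t) (D : SearchInput K d t) {g : ActionFn K d}
    (hg : IsPolicy g) : (D.delta * (K : ℝ)⁻¹) ^ ((t - 1) * K) ≤ D.potential g := by
  have hδ := D.delta_pos ht
  have := Finset.prod_le_prod (s := (Finset.univ : Finset (Fin (t - 1) × Fin K)))
    (f := fun _ => D.delta * (K : ℝ)⁻¹)
    (fun i _ => by positivity) fun i _ => mixDesign_ge (D.delta_le_one ht) hg i.2 (D.obs i.1).ctx
  simpa [potential] using this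

/-- The action probabilities sum to one, so the shift `K / δ` that makes the costs nonnegative adds
the same constant for every policy. -/
theorem sum_spreadCost (D : SearchInput K d t) {f : ActionFn K d} (hf : IsPolicy f)
    (g : ActionFn K d) : ∑ a, ∑ s, D.spreadCost g a s * f a (D.obs s).ctx
      = (t - 1 : ℕ) * (K / D.delta) - D.spread f g := by
  rw [Finset.sum_comm]
  simp only [spreadCost, sub_mul, Finset.sum_sub_distrib, ← Finset.mul_sum, hf.sum_eq_one, spread]
  simp [div_eq_inv_mul, mul_comm]

theorem spread_le (hK : 0 < K) (ht : 1 ≤ t) (D : SearchInput K d t) {f g : ActionFn K d}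
    (hf : IsPolicy f) (hg : IsPolicy g) : D.spread f g ≤ (t - 1 : ℕ) * (K / D.delta) := by
  rw [← sub_nonneg, ← D.sum_spreadCost hf g]
  refine Finset.sum_nonneg fun a _ => Finset.sum_nonneg fun s _ =>
    mul_nonneg ?_ (hf.nonneg _ _)
  exact sub_nonneg.2 (D.inv_mixDesign_le hK ht hg _ _)

theorem potential_step (hK : 0 < K) (ht : 1 ≤ t - 1) (D : SearchInput K d t)
    {f g : ActionFn K d} (hf : IsPolicy f) (hg : IsPolicy g)
    (h : ¬ D.spread f g ≤ 2 * K * (t - 1 : ℕ)) :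
    25 / 24 * D.potential g ≤ D.potential ((1 - stepSize K t) • g + stepSize K t • f) := by
  have hK' : (0 : ℝ) < K := by exact_mod_cast hK
  have ht1 : 1 ≤ t := by omega
  have hn : (0 : ℝ) < (t - 1 : ℕ) := by exact_mod_cast ht
  have hδ := D.delta_pos ht1
  have hδ1 := D.delta_le_one ht1
  push Not at h
  -- For `δ > 1 / 2` the trivial bound `K / δ` per context is already below `2 * K`, so no violation
  -- can occur.
  have hδ2 : D.delta ≤ 1 / 2 := by
    by_contra hcon
    push Not at hcon
    have h1 : (K : ℝ) / D.delta ≤ 2 * K := by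
      rw [div_le_iff₀ hδ]; nlinarith
    have h2 := D.spread_le hK ht1 hf hg
    nlinarith [mul_le_mul_of_nonneg_left h1 hn.le]
  have : Nonempty (Fin (t - 1) × Fin K) := ⟨(⟨0, ht⟩, ⟨0, hK⟩)⟩
  have hpos := fun a w => mixDesign_pos hK hδ hδ1 hg a w
  have key := prod_convex_step
    (fun i : Fin (t - 1) × Fin K => mixDesign D.delta g i.2 (D.obs i.1).ctx)
    (fun i => mixDesign D.delta f i.2 (D.obs i.1).ctx)
    (fun i => hpos _ _) (fun i => (mixDesign_pos hK hδ hδ1 hf _ _).le) ?_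
  · simp only [potential, mixDesign_convex]
    simpa [stepSize] using key
  · rw [Fintype.sum_prod_type]
    have hinv : (t - 1 : ℕ) * (K : ℝ) ^ 2 ≤
        ∑ s : Fin (t - 1), ∑ a, (mixDesign D.delta g a (D.obs s).ctx)⁻¹ := by
      have := Finset.sum_le_sum fun (s : Fin (t - 1)) (_ : s ∈ Finset.univ) =>
        sq_le_sum_inv (fun a => mixDesign D.delta g a (D.obs s).ctx) (fun a => hpos _ _)
          ((isPolicy_mixDesign hK hδ hδ1 hg).sum_eq_one _)
      simpa using this
    have heq : ∑ s : Fin (t - 1), ∑ a,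
        mixDesign D.delta f a (D.obs s).ctx / mixDesign D.delta g a (D.obs s).ctx
        = D.delta * (K : ℝ)⁻¹ * ∑ s : Fin (t - 1), ∑ a, (mixDesign D.delta g a (D.obs s).ctx)⁻¹
          + (1 - D.delta) * D.spread f g := by
      simp only [spread, Finset.mul_sum, ← Finset.sum_add_distrib]
      refine Finset.sum_congr rfl fun s _ => Finset.sum_congr rfl fun a _ => ?_
      rw [div_eq_mul_inv, div_eq_mul_inv]
      conv_lhs => rw [mixDesign, uniformDesign]
      ring
    have h1 : D.delta * (K : ℝ)⁻¹ * ((t - 1 : ℕ) * (K : ℝ) ^ 2)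
        = D.delta * ((t - 1 : ℕ) * (K : ℝ)) := by field_simp
    have h2 := mul_le_mul_of_nonneg_left hinv (by positivity : 0 ≤ D.delta * (K : ℝ)⁻¹)
    have h3 := mul_le_mul_of_nonneg_left h.le (by linarith : 0 ≤ 1 - D.delta)
    have h4 : 0 < ((t - 1 : ℕ) : ℝ) * (K : ℝ) := by positivity
    simp only [Fintype.card_prod, Fintype.card_fin, Nat.cast_mul]
    rw [heq]
    -- The ratio sum is at least `δ * N + (1 - δ) * 2 * N = (2 - δ) * N`, hence at least `3 / 2 * N`
    -- as `δ ≤ 1 / 2`.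
    nlinarith

theorem calls_explore (D : SearchInput K d t) (ht : 1 ≤ t - 1) (b : ℕ → ℝ)
    (ls cc : OracleQuery K d → ActionFn K d) (k : ℕ) (g : ActionFn K d) :
    (D.explore ht b k g).calls ls cc ≤ k := by
  induction k generalizing g with
  | zero => simp [explore, OracleProc.calls]
  | succ k ih =>
    simp only [explore, OracleProc.calls]
    split_ifs
    · simp [OracleProc.calls]
    · exact Nat.succ_le_succ (ih _)

/-- The hypothesis `hk` is the invariant: the remaining growth would push the potential above `1`. A
step spends one factor `25 / 24` and gains at least as much, so the requirement must be met before
the fuel runs out. -/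
theorem run_explore (hK : 0 < K) (ht : 1 ≤ t - 1) (D : SearchInput K d t)
    {F : Set (ActionFn K d)} (hF : IsPolicyClass F) {ls cc : OracleQuery K d → ActionFn K d}
    (hcc : IsLCCSCO F cc) (b : ℕ → ℝ) (k : ℕ) (g : ActionFn K d)
    (hg : g ∈ D.sublevel F (t - 1) b) (hk : 1 < (25 / 24) ^ k * D.potential g) :
    (D.explore ht b k g).run ls cc ∈ D.sublevel F (t - 1) b ∧
      ∀ f ∈ D.sublevel F (t - 1) b,
        D.spread f ((D.explore ht b k g).run ls cc) ≤ 2 * K * (t - 1 : ℕ) := by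
  have ht1 : 1 ≤ t := by omega
  induction k generalizing g with
  | zero =>
    have := D.potential_le_one hK ht1 (hF.isPolicy g hg.1)
    norm_num at hk
    linarith
  | succ k ih =>
    have hgp := hF.isPolicy g hg.1
    obtain ⟨hfeas, hmin⟩ := hcc.solvesCC hF (D.query ht (D.spreadCost g) (t - 1) b)
      (fun a s => sub_nonneg.2 (D.inv_mixDesign_le hK ht1 hgp _ _))
      ⟨g, (D.query_feasible_iff ht _ le_rfl b F g).2 hg⟩
    simp only [explore, OracleProc.run]
    set f := cc (D.query ht (D.spreadCost g) (t - 1) b)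
    have hf := (D.query_feasible_iff ht _ le_rfl b F f).1 hfeas
    have hfp := hF.isPolicy f hf.1
    split_ifs with hs
    -- The oracle's `f` maximizes the spread over the candidates, so testing `f` alone tests them
    -- all.
    · refine ⟨hg, fun f' hf' => le_trans ?_ hs⟩
      have h : ∑ a, ∑ s, D.spreadCost g a s * f a (D.obs s).ctx
          ≤ ∑ a, ∑ s, D.spreadCost g a s * f' a (D.obs s).ctx :=
        hmin f' ((D.query_feasible_iff ht _ le_rfl b F f').2 hf')
      rw [D.sum_spreadCost hfp, D.sum_spreadCost (hF.isPolicy f' hf'.1)] at h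
      simp only [OracleProc.run]
      linarith
    · have hK1 : (1 : ℝ) ≤ K := by exact_mod_cast hK
      have hn1 : (1 : ℝ) ≤ (t - 1 : ℕ) := by exact_mod_cast ht
      have hl0 : 0 ≤ stepSize K t := by unfold stepSize; positivity
      have hl1 : stepSize K t ≤ 1 := by
        unfold stepSize
        rw [div_le_one (by positivity)]
        nlinarith
      refine ih _ (D.convex_sublevel hF.convex _ _ hg hf (by linarith) hl0 (by ring)) ?_
      refine hk.trans_le ?_
      rw [pow_succ, mul_assoc]
      gcongr
      exact D.potential_step hK ht hfp hgp hs

/-! ### The elimination phase -/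

/-- The elimination phase: the minimal empirical risks over the candidate sets at the `k` times
after `τ` are computed one after the other, and `next` is called with the resulting bounds. -/
def eliminate (D : SearchInput K d t) (ht : 1 ≤ t - 1) (next : (ℕ → ℝ) → OracleProc K d) :
    ℕ → ℕ → (ℕ → ℝ) → OracleProc K d
  | 0, _, b => next b
  | k + 1, τ, b => .callCC (D.query ht (D.riskCoef (τ + 1)) τ b) fun f =>
      D.eliminate ht next k (τ + 1) (Function.update b τ (D.empRisk (τ + 1) f + D.x (τ + 1)))

theorem calls_eliminate (D : SearchInput K d t) (ht : 1 ≤ t - 1)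
    (next : (ℕ → ℝ) → OracleProc K d) (ls cc : OracleQuery K d → ActionFn K d) (T : ℕ)
    (hT : ∀ b, (next b).calls ls cc ≤ T) (k τ : ℕ) (b : ℕ → ℝ) :
    (D.eliminate ht next k τ b).calls ls cc ≤ T + k := by
  induction k generalizing τ b with
  | zero => exact hT b
  | succ k ih => exact Nat.succ_le_succ (ih _ _)

/-- Invariant: the set at time `τ + 1` is described by the first `τ` bounds. The oracle's minimizer
turns the comparison with every candidate into a single linear constraint. -/
theorem run_eliminate (hK : 0 < K) (ht : 1 ≤ t - 1) (D : SearchInput K d t)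
    {F : Set (ActionFn K d)} (hF : IsPolicyClass F) {ls cc : OracleQuery K d → ActionFn K d}
    (hcc : IsLCCSCO F cc) (next : (ℕ → ℝ) → OracleProc K d) (k τ : ℕ) (b : ℕ → ℝ)
    (hτ : τ + k = t - 1) (hb : D.candidates F (τ + 1) = D.sublevel F τ b)
    (hne : (D.sublevel F τ b).Nonempty) :
    ∃ b', D.candidates F t = D.sublevel F (t - 1) b' ∧ (D.sublevel F (t - 1) b').Nonempty ∧
      (D.eliminate ht next k τ b).run ls cc = (next b').run ls cc := by
  induction k generalizing τ b with
  | zero =>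
    obtain rfl : τ = t - 1 := by omega
    rw [Nat.sub_add_cancel (by omega)] at hb
    exact ⟨b, hb, hne, rfl⟩
  | succ k ih =>
    have hiff := D.query_feasible_iff ht (D.riskCoef (τ + 1)) (τ := τ) (by omega) b F
    obtain ⟨hfeas, hmin⟩ := hcc.solvesCC hF (D.query ht (D.riskCoef (τ + 1)) τ b)
      (fun a s => D.riskCoef_nonneg hK _ a s) (hne.imp fun g hg => (hiff g).2 hg)
    set f := cc (D.query ht (D.riskCoef (τ + 1)) τ b) with hfdef
    have hf := (hiff f).1 hfeas
    have hle : ∀ f' ∈ D.sublevel F τ b, D.empRisk (τ + 1) f ≤ D.empRisk (τ + 1) f' := by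
      intro f' hf'
      rw [← D.sum_riskCoef, ← D.sum_riskCoef]
      exact hmin f' ((hiff f').2 hf')
    have hsub : D.sublevel F (τ + 1)
        (Function.update b τ (D.empRisk (τ + 1) f + D.x (τ + 1)))
        = {g | g ∈ D.sublevel F τ b ∧ D.empRisk (τ + 1) g ≤ D.empRisk (τ + 1) f + D.x (τ + 1)} := by
      ext g
      refine ⟨fun h => ⟨⟨h.1, fun m hm => ?_⟩, ?_⟩, fun h => ⟨h.1.1, fun m hm => ?_⟩⟩
      · have := h.2 m (by omega)
        rwa [Function.update_of_ne hm.ne] at this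
      · simpa using h.2 τ (by omega)
      · rcases Nat.lt_succ_iff_lt_or_eq.1 hm with hm | rfl
        · rw [Function.update_of_ne hm.ne]
          exact h.1.2 m hm
        · simpa using h.2
    -- A nonnegative threshold keeps the minimizer itself, so the next set is nonempty.
    have hx := D.x_nonneg (τ + 1) (by omega)
    refine ih (τ + 1) _ (by omega) ?_ ?_
    · rw [hsub, candidates, hb]
      ext g
      refine and_congr_right fun _ => ⟨fun h => h f hf, fun h f' hf' => ?_⟩
      linarith [hle f' hf']
    · rw [hsub]
      exact ⟨f, hf, by linarith⟩

/-! ### The search procedure -/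

/-- The number of steps allowed in the exploration phase. -/
def fuel (K t : ℕ) : ℕ := ⌊25 * ((K : ℝ) * t) * Real.log (K * t)⌋₊ + 1

/-- A query without effective constraints, used when there are no observations. -/
def trivialQuery (K d : ℕ) : OracleQuery K d where
  n := 1
  n_pos := le_rfl
  q := 1
  q_pos := le_rfl
  ctx := 0
  vec := 0
  u _ _ _ := 0
  b _ := 0

/-- The procedure that carries out the exploration policy search step. -/
def search (K d t : ℕ) (D : SearchInput K d t) : OracleProc K d :=
  if ht : 1 ≤ t - 1 then
    D.eliminate ht
      (fun b => .callCC (D.query ht 0 (t - 1) b) fun g => D.explore ht b (fuel K t) g) (t - 1) 0 0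
  else .callCC (trivialQuery K d) .output

theorem one_lt_pow_fuel_mul_potential (hK : 0 < K) (ht : 1 ≤ t) (D : SearchInput K d t)
    {g : ActionFn K d} (hg : IsPolicy g) : 1 < (25 / 24) ^ fuel K t * D.potential g := by
  have hK' : (1 : ℝ) ≤ K := by exact_mod_cast hK
  have ht' : (1 : ℝ) ≤ t := by exact_mod_cast ht
  have hKt : (1 : ℝ) ≤ K * t := one_le_mul_of_one_le_of_one_le hK' ht'
  have hbase : ((K : ℝ) * t)⁻¹ ≤ D.delta * (K : ℝ)⁻¹ := by
    rw [mul_inv, mul_comm]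
    have : (t : ℝ)⁻¹ ≤ D.delta := inv_le_rate ht
    gcongr
  have hpot : (((K : ℝ) * t) ^ (t * K))⁻¹ ≤ D.potential g := by
    refine le_trans ?_ (D.le_potential ht hg)
    rw [← inv_pow]
    calc ((K : ℝ) * t)⁻¹ ^ (t * K) ≤ ((K : ℝ) * t)⁻¹ ^ ((t - 1) * K) :=
          pow_le_pow_of_le_one (by positivity) (inv_le_one_of_one_le₀ hKt)
            (Nat.mul_le_mul_right _ (Nat.sub_le _ _))
      _ ≤ _ := by gcongr
  have hlt : ((K : ℝ) * t) ^ (t * K) < (25 / 24) ^ fuel K t := by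
    rw [← Real.log_lt_log_iff (by positivity) (by positivity), Real.log_pow, Real.log_pow]
    -- The source of the constant `25` in `fuel`.
    have h1 : (1 : ℝ) / 25 ≤ Real.log (25 / 24) := by
      have := Real.one_sub_inv_le_log_of_pos (x := 25 / 24) (by norm_num)
      norm_num at this ⊢
      linarith
    have h2 : 25 * ((K : ℝ) * t) * Real.log (K * t) < fuel K t := by
      have := Nat.lt_floor_add_one (25 * ((K : ℝ) * t) * Real.log (K * t))
      simpa [fuel] using this
    have h3 : (fuel K t : ℝ) * (1 / 25) ≤ fuel K t * Real.log (25 / 24) := by gcongr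
    push_cast
    linarith
  have hpos : 0 < ((K : ℝ) * t) ^ (t * K) := by positivity
  calc (1 : ℝ) = ((K : ℝ) * t) ^ (t * K) * (((K : ℝ) * t) ^ (t * K))⁻¹ :=
        (mul_inv_cancel₀ hpos.ne').symm
    _ < (25 / 24) ^ fuel K t * (((K : ℝ) * t) ^ (t * K))⁻¹ := by gcongr
    _ ≤ _ := by gcongr

theorem run_search (hK : 0 < K) (ht : 1 ≤ t) (D : SearchInput K d t) {F : Set (ActionFn K d)}
    (hF : IsPolicyClass F) {ls cc : OracleQuery K d → ActionFn K d} (hcc : IsLCCSCO F cc) :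
    D.IsExplorationPolicy F ((search K d t D).run ls cc) := by
  unfold search
  split_ifs with h
  · obtain ⟨b, hb, ⟨g₀, hg₀⟩, hrun⟩ := D.run_eliminate hK h hF (ls := ls) hcc
      (fun b => .callCC (D.query h 0 (t - 1) b) fun g => D.explore h b (fuel K t) g)
      (t - 1) 0 0 (by omega) (by simp [candidates, sublevel])
      (by simpa [sublevel] using hF.nonempty)
    rw [hrun]
    simp only [OracleProc.run]
    have hiff := D.query_feasible_iff h 0 le_rfl b F
    have hg := (hiff _).1 (hcc.solvesCC hF (D.query h 0 (t - 1) b) (fun _ _ => le_rfl)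
      ⟨g₀, (hiff g₀).2 hg₀⟩).1
    have hexp := D.run_explore hK h hF (ls := ls) hcc b (fuel K t) _ hg
      (D.one_lt_pow_fuel_mul_potential hK ht (hF.isPolicy _ hg.1))
    refine ⟨hb ▸ hexp.1, fun f hf => ?_⟩
    have hs := hexp.2 f (hb ▸ hf)
    rw [Nat.cast_sub ht, Nat.cast_one] at hs
    have hpos : (0 : ℝ) < (t : ℝ) - 1 := by
      have : (1 : ℝ) < t := by exact_mod_cast (by omega : 1 < t)
      linarith
    rw [one_div_mul_eq_div, div_le_iff₀ hpos]
    exact hs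
  -- Without observations the candidate set is `F` and the inequality is an empty sum, so any member
  -- of `F` will do.
  · obtain rfl : t = 1 := by omega
    have := hcc.solvesCC hF (trivialQuery K d) (fun _ _ => le_rfl)
      (hF.nonempty.imp fun f hf => ⟨hf, fun m => by simp [trivialQuery]⟩)
    exact ⟨this.1.1, fun f _ => by simp⟩

theorem calls_search (hK : 2 ≤ K) (ht : 1 ≤ t) (D : SearchInput K d t)
    (ls cc : OracleQuery K d → ActionFn K d) :
    ((search K d t D).calls ls cc : ℝ) ≤
      100 * ((K : ℝ) * (t : ℝ)) ^ 2 * Real.log (max (t : ℝ) 2) := by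
  have hK' : (2 : ℝ) ≤ K := by exact_mod_cast hK
  have ht' : (1 : ℝ) ≤ t := by exact_mod_cast ht
  set L := Real.log (max (t : ℝ) 2) with hL
  have hL2 : 1 / 2 ≤ L := by
    have h1 : Real.log 2 ≤ L := Real.log_le_log (by norm_num) (le_max_right _ _)
    linarith [Real.log_two_gt_d9]
  have htL : Real.log t ≤ L := Real.log_le_log (by linarith) (le_max_left _ _)
  -- Here `log K ≤ K - 1 ≤ 2 * K * L` because `L ≥ 1 / 2`. The lossy factor `K` is affordable: the
  -- target is quadratic in `K * t`.
  have hlog : Real.log (K * t) ≤ 3 * K * L := by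
    rw [Real.log_mul (by positivity) (by positivity)]
    have := Real.log_le_sub_one_of_pos (by linarith : (0 : ℝ) < K)
    nlinarith
  have hlog0 : 0 ≤ Real.log (K * t) := Real.log_nonneg (by nlinarith)
  have hfuel : (fuel K t : ℝ) ≤ 25 * ((K : ℝ) * t) * Real.log (K * t) + 1 := by
    have := Nat.floor_le (by positivity : 0 ≤ 25 * ((K : ℝ) * t) * Real.log (K * t))
    simpa [fuel] using this
  have hcalls : (search K d t D).calls ls cc ≤ fuel K t + t := by
    unfold search
    split_ifs with h
    · refine (D.calls_eliminate h _ ls cc (fuel K t + 1) (fun b => ?_) _ _ _).trans (by omega)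
      exact Nat.succ_le_succ (D.calls_explore h b ls cc _ _)
    · simp only [OracleProc.calls]
      omega
  have hcalls' : ((search K d t D).calls ls cc : ℝ) ≤ fuel K t + t := by exact_mod_cast hcalls
  have h1 : 25 * ((K : ℝ) * t) * Real.log (K * t) ≤ 75 * ((K : ℝ) ^ 2 * t) * L := by
    have := mul_le_mul_of_nonneg_left hlog (by positivity : 0 ≤ 25 * ((K : ℝ) * t))
    nlinarith
  have h2 : (K : ℝ) ^ 2 * t ≤ ((K : ℝ) * t) ^ 2 := by
    nlinarith [mul_le_mul_of_nonneg_left ht' (by positivity : 0 ≤ (K : ℝ) ^ 2 * t)]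
  have h3 : 4 * (t : ℝ) ≤ (K : ℝ) ^ 2 * t := by gcongr; nlinarith
  have h4 := mul_le_mul_of_nonneg_right h2 (by linarith : 0 ≤ L)
  have h5 : (t : ℝ) ≤ ((K : ℝ) * t) ^ 2 * L := by nlinarith
  linarith

end SearchInput

end GPE

end

theorem mainTheorem7 :
    ∃ C : ℝ, 0 < C ∧
      ∃ search : (K d t : ℕ) → GPE.SearchInput K d t → GPE.OracleProc K d,
        ∀ (K d t : ℕ), 2 ≤ K → 1 ≤ t →
        ∀ (D : GPE.SearchInput K d t)
          (F : Set (GPE.ActionFn K d)) (ls cc : GPE.OracleQuery K d → GPE.ActionFn K d),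
          GPE.IsPolicyClass F → GPE.IsLCLSO F ls → GPE.IsLCCSCO F cc →
            D.IsExplorationPolicy F ((search K d t D).run ls cc) ∧
            ((search K d t D).calls ls cc : ℝ) ≤
              C * ((K : ℝ) * (t : ℝ)) ^ 2 * Real.log (max (t : ℝ) 2) := by
  exact ⟨100, by norm_num, GPE.SearchInput.search, fun K d t hK ht D F ls cc hF _ hcc =>
    ⟨D.run_search (by omega) ht hF hcc, D.calls_search hK ht ls cc⟩⟩
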